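/- Throughout, $\mathcal S$ is the class of small categories $\mathcal C$ such that: (C1) every monomorphism of $\mathcal C$ has a pullback along every morphism with the same codomain; (C2) for all monomorphisms $\alpha:i\to j$ and $\beta:j\to k$ there are monomorphisms $\gamma:i\to l$ and $\delta:l\to k$ such that the square $\delta\gamma=\beta\alpha$ is a pullback of $\delta$ and $\beta$, and such that for all $\xi:m\to i$, $\eta:m\to n$, $\zeta:n\to k$ for which $\zeta\eta=\beta(\alpha\xi)$ is a pullback square of $\zeta$ and $\beta$, there is $\varphi:n\to l$ with $\delta\varphi=\zeta$ and $\varphi\eta=\gamma\xi$. For $\mathcal C$ satisfying (C1), the partialization $\mathcal P(\mathcal C)$ has the objects of $\mathcal C$; its morphisms $i\to j$ are the diagrams $i\overset{\alpha}{\hookleftarrow}k\overset{f}{\to}j$ with $\alpha$ a monomorphism, modulo isomorphisms of $k$ compatible with $\alpha$ and $f$, and they are composed through pullbacks. If $\mathcal C\in\mathcal S$ then $\mathcal P(\mathcal C)\in\mathcal S$, and $\mathcal P(\mathcal C)$ has the same monomorphisms as $\mathcal C$ (embedded by $f\mapsto (i\overset{1}{\hookleftarrow}i\overset{f}{\to}j)$).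 Hence the iterations $\mathcal P^n(\mathcal C)$, $n\ge 0$, are defined, and the morphisms $i\to j$ of $\mathcal P^n(\mathcal C)$ are identified with the diagrams $$i\overset{\alpha_n}{\hookleftarrow}k_n\overset{\alpha_{n-1}}{\hookleftarrow}\cdots\overset{\alpha_1}{\hookleftarrow}k_1\overset{f}{\to}j$$ in $\mathcal C$, with all $\alpha_r$ monomorphisms, modulo isomorphisms of the nodes $k_1,\dots,k_n$ compatible with all arrows. Put $k_{n+1}=i$. A functor $F:\mathcal C\to\mathcal C'$ between members of $\mathcal S$ that preserves monomorphisms induces a map $\mathcal P^n(F)$ on objects and morphisms, $\mathcal P^n(\mathcal C)\to\mathcal P^n(\mathcal C')$, by applying $F$ to all nodes and arrows of a diagram. For $n\ge1$ and $1\le s\le n+1$ let $\mathfrak f_n^{(s)}:\mathcal P^n(\mathcal C)\to\mathcal P^{n+1}(\mathcal C)$ be the identity on objects and, on morphisms, double the node $k_s$ (replace $k_s$ by $k_s\overset{1}{\hookleftarrow}k_s$). For $n\ge2$ and $2\le s\le n$ let $\mathfrak t_n^{(s)}:\mathcal P^n(\mathcal C)\to\mathcal P^{n-1}(\mathcal C)$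 be the identity on objects and, on morphisms, delete the node $k_s$ (with $\alpha_s\alpha_{s-1}:k_{s-1}\hookrightarrow k_{s+1}$ as the new arrow). A natural transformation $\tau$ from $\mathcal P^n$ to $\mathcal P^m$ means that every $\tau_{\mathcal C}$, $\mathcal C\in\mathcal S$, is a functor preserving monomorphisms, and that $\tau_{\mathcal C'}\,\mathcal P^n(F)=\mathcal P^m(F)\,\tau_{\mathcal C}$ for every functor $F:\mathcal C\to\mathcal C'$ between members of $\mathcal S$ that preserves monomorphisms. **Proposition.** Whenever the indices are such that the maps involved are defined: (i) $\mathfrak f_n^{(s)}$ is a natural transformation from $\mathcal P^n$ to $\mathcal P^{n+1}$, and it is injective on each set of morphisms. (ii) $\mathfrak t_n^{(s)}$ is a natural transformation from $\mathcal P^n$ to $\mathcal P^{n-1}$, and it is surjective on each set of morphisms. (iii) For $n\ge1$: $\mathfrak t_{n+1}^{(s)}\mathfrak f_n^{(s)}$ (for $2\le s\le n+1$) and $\mathfrak t_{n+1}^{(s+1)}\mathfrak f_n^{(s)}$ (for $1\le s\le n$) are the identity. (iv) $\mathfrak t_{n+1}^{(r)}\mathfrak f_n^{(s)}=\mathfrak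 f_{n-1}^{(s)}\mathfrak t_n^{(r-1)}$ if $n\ge2$, $1\le s$, $s+1<r\le n+1$. (v) $\mathfrak t_{n+1}^{(r)}\mathfrak f_n^{(s)}=\mathfrak f_{n-1}^{(s-1)}\mathfrak t_n^{(r)}$ if $n\ge2$, $2\le r<s\le n+1$. -/

import Mathlib

open CategoryTheory CategoryTheory.Limits

universe u

/-! ## The two conditions on a category -/

/-- Every monomorphism has a pullback along every morphism with the same codomain. -/
class HasMonoPullbacks (C : Type u) [SmallCategory C] : Prop where
  hasPullback : ∀ {i j k : C} (f : i ⟶ j) (α : k ⟶ j) [Mono α], HasPullback f α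

/-- The square `γ ≫ δ = α ≫ β` is a complement diagram for the monomorphisms `α : i ⟶ j` and
`β : j ⟶ k`: it is a pullback, and every pullback square over `β` whose upper corner factors
through `α` is mapped to it. -/
structure IsComplement {C : Type u} [SmallCategory C] {i j k l : C}
    (α : i ⟶ j) (β : j ⟶ k) (γ : i ⟶ l) (δ : l ⟶ k) : Prop where
  isPullback : IsPullback γ α δ β
  exists_lift : ∀ {m n : C} (ξ : m ⟶ i) (η : m ⟶ n) (ζ : n ⟶ k),
    IsPullback η (ξ ≫ α) ζ β → ∃ φ : n ⟶ l, φ ≫ δ = ζ ∧ η ≫ φ = ξ ≫ γ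

theorem isComplement_id {C : Type u} [SmallCategory C] {i j : C} (γ : i ⟶ j) : IsComplement γ (𝟙 j) (𝟙 i) γ where
  isPullback := IsPullback.id_horiz γ
  exists_lift ξ η ζ h := by
    have := h.isIso_fst_of_isIso
    refine ⟨inv η ≫ ξ, ?_, by simp⟩
    rw [Category.assoc, IsIso.inv_comp_eq]
    simpa using h.w.symm

/-- Any two composable monomorphisms admit a complement diagram. -/
class HasComplements (C : Type u) [SmallCategory C] : Prop where
  exists_isComplement : ∀ {i j k : C} (α : i ⟶ j) (β : j ⟶ k) [Mono α] [Mono β],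
    ∃ (l : C) (γ : i ⟶ l) (δ : l ⟶ k), Mono γ ∧ Mono δ ∧ IsComplement α β γ δ

/-! ## The partialization of a category -/

/-- The diagram `i ↩ dom ⟶ j`, a partially defined morphism from `i` to `j`. -/
structure PartialArrow {C : Type u} [SmallCategory C] (i j : C) : Type u where
  dom : C
  incl : dom ⟶ i
  hom : dom ⟶ j
  mono : Mono incl

namespace PartialArrow

variable {C : Type u} [SmallCategory C]

attribute [instance] PartialArrow.mono

/-- Equivalence of diagrams: an isomorphism of the middle objects commuting with both legs. -/
def Equiv {i j : C} (a b : PartialArrow i j) : Prop :=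
  ∃ γ : a.dom ≅ b.dom, γ.hom ≫ b.incl = a.incl ∧ γ.hom ≫ b.hom = a.hom

instance setoid (i j : C) : Setoid (PartialArrow i j) where
  r := Equiv
  iseqv :=
    { refl := fun _ => ⟨Iso.refl _, by simp, by simp⟩
      symm := fun ⟨γ, h₁, h₂⟩ => ⟨γ.symm, by simp [← h₁], by simp [← h₂]⟩
      trans := fun ⟨γ, h₁, h₂⟩ ⟨γ', h₁', h₂'⟩ =>
        ⟨γ ≪≫ γ', by simp [h₁, h₁'], by simp [h₂, h₂']⟩ }

/-- The everywhere defined arrow given by a morphism. -/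
def ofHom {i j : C} (f : i ⟶ j) : PartialArrow i j := ⟨i, 𝟙 i, f, inferInstance⟩

variable [HasMonoPullbacks C]

/-- Composition of partial arrows through the pullback of `b.incl` along `a.hom`. -/
noncomputable def comp {i j k : C} (a : PartialArrow i j) (b : PartialArrow j k) :
    PartialArrow i k :=
  haveI := HasMonoPullbacks.hasPullback a.hom b.incl
  ⟨pullback a.hom b.incl, pullback.fst a.hom b.incl ≫ a.incl,
    pullback.snd a.hom b.incl ≫ b.hom, inferInstance⟩

theorem comp_equiv_of_isPullback {i j k : C} (a : PartialArrow i j) (b : PartialArrow j k)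
    {m : C} {p : m ⟶ a.dom} {q : m ⟶ b.dom} (h : IsPullback p q a.hom b.incl)
    (c : PartialArrow i k) (e : c.dom ≅ m)
    (hi : e.hom ≫ p ≫ a.incl = c.incl) (hh : e.hom ≫ q ≫ b.hom = c.hom) :
    Equiv (comp a b) c := by
  have := HasMonoPullbacks.hasPullback a.hom b.incl
  have h' := IsPullback.of_hasPullback a.hom b.incl
  refine ⟨(h'.isoIsPullback _ _ h) ≪≫ e.symm, ?_, ?_⟩
  · rw [← hi]; simp [comp]
  · rw [← hh]; simp [comp]

theorem comp_congr {i j k : C} {a a' : PartialArrow i j} {b b' : PartialArrow j k}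
    (ha : Equiv a a') (hb : Equiv b b') : Equiv (comp a b) (comp a' b') := by
  obtain ⟨γ, h₁, h₂⟩ := ha
  obtain ⟨δ, h₃, h₄⟩ := hb
  have := HasMonoPullbacks.hasPullback a'.hom b'.incl
  have h' := IsPullback.of_hasPullback a'.hom b'.incl
  have h : IsPullback (pullback.fst a'.hom b'.incl ≫ γ.inv)
      (pullback.snd a'.hom b'.incl ≫ δ.inv) a.hom b.incl :=
    h'.of_iso (Iso.refl _) γ.symm δ.symm (Iso.refl _) (by simp) (by simp)
      (by simp [← h₂]) (by simp [← h₃])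
  refine comp_equiv_of_isPullback a b h _ (Iso.refl _) ?_ ?_
  · simp [comp, ← h₁]
  · simp [comp, ← h₄]

theorem id_comp_equiv {i j : C} (a : PartialArrow i j) : Equiv (comp (ofHom (𝟙 i)) a) a :=
  comp_equiv_of_isPullback _ _ (IsPullback.id_horiz a.incl).flip a (Iso.refl _)
    (by simp [ofHom]) (by simp)

theorem comp_id_equiv {i j : C} (a : PartialArrow i j) : Equiv (comp a (ofHom (𝟙 j))) a :=
  comp_equiv_of_isPullback _ _ (IsPullback.id_horiz a.hom) a (Iso.refl _)
    (by simp) (by simp [ofHom])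

theorem assoc_equiv {i j k l : C} (a : PartialArrow i j) (b : PartialArrow j k)
    (c : PartialArrow k l) : Equiv (comp (comp a b) c) (comp a (comp b c)) := by
  have := HasMonoPullbacks.hasPullback a.hom b.incl
  have := HasMonoPullbacks.hasPullback b.hom c.incl
  have := HasMonoPullbacks.hasPullback a.hom (comp b c).incl
  have hP := IsPullback.of_hasPullback a.hom b.incl
  have hQ := IsPullback.of_hasPullback b.hom c.incl
  have hT := IsPullback.of_hasPullback a.hom (comp b c).incl
  have w : pullback.fst a.hom (comp b c).incl ≫ a.hom =
      (pullback.snd a.hom (comp b c).incl ≫ pullback.fst b.hom c.incl) ≫ b.incl :=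
    hT.w.trans (Category.assoc _ _ _).symm
  have hA : IsPullback (pullback.snd a.hom (comp b c).incl) (hP.lift _ _ w)
      (pullback.fst b.hom c.incl) (pullback.snd a.hom b.incl) := by
    refine IsPullback.of_bot (v₂₁ := pullback.fst a.hom b.incl) (v₂₂ := b.incl) (h₃₁ := a.hom)
      ?_ (by simp) hP.flip
    rw [hP.lift_fst]
    exact hT.flip
  refine comp_equiv_of_isPullback (comp a b) c (hA.paste_horiz hQ.flip).flip _ (Iso.refl _) ?_ ?_
  · simp [comp]
  · simp [comp]

end PartialArrow

/-- The partialization `𝒫(C)`: the same objects as `C`, and equivalence classes of partial arrows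
as morphisms. -/
def Partialization (C : Type u) : Type u := C

namespace Partialization

section Category

/-- An object of `C`, seen as an object of `𝒫(C)`. -/
def of (C : Type u) (i : C) : Partialization C := i

theorem ind {C : Type u} {motive : Partialization C → Prop} (h : ∀ i : C, motive (of C i))
    (i : Partialization C) : motive i :=
  h i

variable {C : Type u} [SmallCategory C] [HasMonoPullbacks C]

noncomputable instance : CategoryStruct.{u} (Partialization C) where
  Hom i j := Quotient (PartialArrow.setoid (C := C) i j)
  id i := Quotient.mk (PartialArrow.setoid (C := C) i i) (PartialArrow.ofHom (@CategoryStruct.id C _ i))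
  comp x y := Quotient.map₂ PartialArrow.comp
    (fun _ _ h _ _ h' => PartialArrow.comp_congr h h') x y

noncomputable instance : SmallCategory (Partialization C) where
  id_comp x := by
    obtain ⟨a, rfl⟩ := Quotient.exists_rep x
    exact Quotient.sound (PartialArrow.id_comp_equiv a)
  comp_id x := by
    obtain ⟨a, rfl⟩ := Quotient.exists_rep x
    exact Quotient.sound (PartialArrow.comp_id_equiv a)
  assoc x y z := by
    obtain ⟨a, rfl⟩ := Quotient.exists_rep x
    obtain ⟨b, rfl⟩ := Quotient.exists_rep y
    obtain ⟨c, rfl⟩ := Quotient.exists_rep z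
    exact Quotient.sound (PartialArrow.assoc_equiv a b c)

/-- The morphism of `𝒫(C)` given by the diagram `i ↩ k ⟶ j`. -/
def mk {i j k : C} (α : k ⟶ i) (f : k ⟶ j) [Mono α] : of C i ⟶ of C j :=
  Quotient.mk (PartialArrow.setoid i j) ⟨k, α, f, inferInstance⟩

theorem exists_rep {i j : C} (x : of C i ⟶ of C j) :
    ∃ (k : C) (α : k ⟶ i) (f : k ⟶ j) (_ : Mono α), x = mk α f := by
  obtain ⟨a, rfl⟩ := Quotient.exists_rep x
  exact ⟨a.dom, a.incl, a.hom, a.mono, rfl⟩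

theorem mk_eq_iff {i j k k' : C} (α : k ⟶ i) (f : k ⟶ j) (α' : k' ⟶ i) (f' : k' ⟶ j)
    [Mono α] [Mono α'] :
    mk α f = mk α' f' ↔ ∃ γ : k ≅ k', γ.hom ≫ α' = α ∧ γ.hom ≫ f' = f :=
  Quotient.eq (r := PartialArrow.setoid i j)

theorem mk_comp_mk {i j k l l' m : C} (α : l ⟶ i) (f : l ⟶ j) (β : l' ⟶ j) (g : l' ⟶ k)
    [Mono α] [Mono β] (p : m ⟶ l) (q : m ⟶ l') [Mono (p ≫ α)] (h : IsPullback p q f β) :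
    mk α f ≫ mk β g = mk (p ≫ α) (q ≫ g) :=
  Quotient.sound (PartialArrow.comp_equiv_of_isPullback ⟨l, α, f, inferInstance⟩
    ⟨l', β, g, inferInstance⟩ h ⟨m, p ≫ α, q ≫ g, inferInstance⟩ (Iso.refl _) (by simp) (by simp))

/-- The canonical inclusion on morphisms. -/
def incl {i j : C} (f : i ⟶ j) : of C i ⟶ of C j := mk (𝟙 i) f

theorem incl_id (i : C) : incl (𝟙 i) = 𝟙 (of C i) := rfl

theorem incl_comp_mk {i j k m l : C} (f : i ⟶ j) (β : l ⟶ j) (g : l ⟶ k) [Mono β]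
    (p : m ⟶ i) (q : m ⟶ l) [Mono p] (h : IsPullback p q f β) :
    incl f ≫ mk β g = mk p (q ≫ g) := by
  have : Mono (p ≫ 𝟙 i) := by simpa
  rw [incl, mk_comp_mk _ _ _ _ p q h]
  simp only [Category.comp_id]

theorem mk_comp_incl {i j k l : C} (α : l ⟶ i) (f : l ⟶ j) [Mono α] (g : j ⟶ k) :
    mk α f ≫ incl g = mk α (f ≫ g) := by
  have : Mono (𝟙 l ≫ α) := by simpa
  rw [incl, mk_comp_mk α f (𝟙 j) g (𝟙 l) f (IsPullback.of_horiz_isIso ⟨by simp⟩)]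
  simp only [Category.id_comp]

theorem incl_comp {i j k : C} (f : i ⟶ j) (g : j ⟶ k) : incl (f ≫ g) = incl f ≫ incl g :=
  (mk_comp_incl (𝟙 i) f g).symm

theorem incl_injective {i j : C} {f g : i ⟶ j} (h : incl f = incl g) : f = g := by
  obtain ⟨γ, h₁, h₂⟩ := (mk_eq_iff _ _ _ _).1 h
  rw [Category.comp_id] at h₁
  rw [← h₂, h₁, Category.id_comp]

instance mono_incl {i j : C} (f : i ⟶ j) [Mono f] : Mono (incl f) := by
  refine ⟨fun {l} x y h => ?_⟩
  induction l using ind with | _ l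
  obtain ⟨m, α, g, _, rfl⟩ := exists_rep x
  obtain ⟨n, β, g', _, rfl⟩ := exists_rep y
  rw [mk_comp_incl, mk_comp_incl, mk_eq_iff] at h
  obtain ⟨γ, h₁, h₂⟩ := h
  rw [← Category.assoc, cancel_mono] at h₂
  exact (mk_eq_iff _ _ _ _).2 ⟨γ, h₁, h₂⟩

/-- The monomorphisms of `𝒫(C)` are the monomorphisms of `C`. -/
theorem exists_eq_incl_of_mono {i j : C} (x : of C i ⟶ of C j) [Mono x] :
    ∃ γ : i ⟶ j, Mono γ ∧ x = incl γ := by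
  obtain ⟨k, α, f, _, rfl⟩ := exists_rep x
  have h : mk α α ≫ mk α f = 𝟙 (of C i) ≫ mk α f := by
    have : Mono (𝟙 k ≫ α) := by simpa
    rw [mk_comp_mk α α α f (𝟙 k) (𝟙 k) (IsKernelPair.id_of_mono α)]
    simp only [Category.id_comp]
  rw [cancel_mono, ← incl_id, incl, mk_eq_iff] at h
  obtain ⟨γ, h₁, -⟩ := h
  rw [Category.comp_id] at h₁
  have hα : mk α f = incl (γ.inv ≫ f) := by
    rw [incl, mk_eq_iff]
    exact ⟨γ, by simpa using h₁, by simp⟩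
  refine ⟨γ.inv ≫ f, ⟨fun {l} a b hab => incl_injective ?_⟩, hα⟩
  rw [← cancel_mono (mk α f), hα, ← incl_comp, ← incl_comp, hab]

/-- Pullbacks of monomorphisms along arbitrary morphisms of `𝒫(C)`. -/
theorem isPullback_mk {i j k l m n : C} (α : k ⟶ i) (f : k ⟶ j) (β : l ⟶ j) [Mono α] [Mono β]
    {β' : m ⟶ k} {f' : m ⟶ l} (h : IsPullback β' f' f β) {α' : m ⟶ n} {β'' : n ⟶ i}
    [Mono α'] [Mono β''] (hc : IsComplement β' α α' β'') :
    IsPullback (incl β'') (mk α' f') (mk α f) (incl β) := by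
  refine IsPullback.mk' ?_ (fun _ _ _ h₁ _ => (cancel_mono (incl β'')).1 h₁) ?_
  · rw [mk_comp_incl, incl_comp_mk β'' α f α' β' hc.isPullback, h.w]
  · intro p x y hxy
    induction p using ind with | _ p
    obtain ⟨d, ε, g, _, rfl⟩ := exists_rep x
    obtain ⟨q, ξ, t, _, rfl⟩ := exists_rep y
    have := HasMonoPullbacks.hasPullback g α
    have hu := IsPullback.of_hasPullback g α
    set u := pullback.fst g α
    set v := pullback.snd g α
    rw [mk_comp_incl, mk_comp_mk ε g α f u v hu, mk_eq_iff] at hxy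
    obtain ⟨θ, h₁, h₂⟩ := hxy
    have hw : v ≫ f = (θ.hom ≫ t) ≫ β := by rw [Category.assoc, h₂]
    obtain ⟨φ, h₃, h₄⟩ := hc.exists_lift (h.lift v _ hw) u g (by rwa [h.lift_fst])
    refine ⟨mk ε φ, ?_, ?_⟩
    · rw [mk_comp_incl, h₃]
    · have hp : IsPullback u (h.lift v _ hw) φ α' := by
        refine (IsPullback.of_right ?_ h₄.symm hc.isPullback.flip).flip
        rw [h₃, h.lift_fst]
        exact hu.flip
      rw [mk_comp_mk ε φ α' f' _ _ hp, h.lift_snd, mk_eq_iff]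
      exact ⟨θ, h₁, rfl⟩

section Conditions

variable [HasComplements C]

instance : HasMonoPullbacks (Partialization C) where
  hasPullback {i j k} x y _ := by
    induction i using ind with | _ i
    induction j using ind with | _ j
    induction k using ind with | _ k
    obtain ⟨β, _, rfl⟩ := exists_eq_incl_of_mono y
    obtain ⟨l, α, f, _, rfl⟩ := exists_rep x
    have := HasMonoPullbacks.hasPullback f β
    obtain ⟨n, γ, δ, _, _, hc⟩ := HasComplements.exists_isComplement (pullback.fst f β) α
    exact (isPullback_mk α f β (IsPullback.of_hasPullback f β) hc).hasPullback

theorem isComplement_incl {i j k l : C} {α : i ⟶ j} {β : j ⟶ k} {γ : i ⟶ l} {δ : l ⟶ k}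
    [Mono α] [Mono β] [Mono γ] [Mono δ] (hc : IsComplement α β γ δ) :
    IsComplement (incl α) (incl β) (incl γ) (incl δ) := by
  have hpb : IsPullback (incl γ) (incl α) (incl δ) (incl β) :=
    isPullback_mk (𝟙 l) δ β hc.isPullback (isComplement_id γ)
  refine ⟨hpb, fun {m n} ξ η ζ h => ?_⟩
  induction m using ind with | _ m
  induction n using ind with | _ n
  obtain ⟨d, ε, g, _, rfl⟩ := exists_rep ζ
  have := HasMonoPullbacks.hasPullback g β
  have hg := IsPullback.of_hasPullback g β
  obtain ⟨n', α', β'', _, _, hc'⟩ := HasComplements.exists_isComplement (pullback.fst g β) ε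
  have h' := isPullback_mk ε g β hg hc'
  let θ := h'.isoIsPullback _ _ h
  have hθ : (θ.hom ≫ ξ) ≫ incl α = mk α' (pullback.snd g β) := by
    rw [Category.assoc]; exact h'.isoIsPullback_hom_snd _ _ h
  obtain ⟨a, b, c, _, hb⟩ := exists_rep (θ.hom ≫ ξ)
  rw [hb, mk_comp_incl, mk_eq_iff] at hθ
  obtain ⟨τ, h₁, h₂⟩ := hθ
  obtain ⟨φ, h₃, -⟩ := hc.exists_lift (τ.inv ≫ c) (pullback.fst g β) g (by
    rwa [Category.assoc, ← h₂, Iso.inv_hom_id_assoc])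
  have h₅ : mk ε φ ≫ incl δ = mk ε g := by rw [mk_comp_incl, h₃]
  refine ⟨mk ε φ, h₅, ?_⟩
  rw [← cancel_mono (incl δ), Category.assoc, h₅, h.w, Category.assoc, Category.assoc, hpb.w]

instance : HasComplements (Partialization C) where
  exists_isComplement {i j k} x y _ _ := by
    induction i using ind with | _ i
    induction j using ind with | _ j
    induction k using ind with | _ k
    obtain ⟨α, _, rfl⟩ := exists_eq_incl_of_mono x
    obtain ⟨β, _, rfl⟩ := exists_eq_incl_of_mono y
    obtain ⟨l, γ, δ, _, _, hc⟩ := HasComplements.exists_isComplement α β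
    exact ⟨of C l, incl γ, incl δ, inferInstance, inferInstance, isComplement_incl hc⟩

end Conditions

/-- The second condition holds exactly when the partialization satisfies the first one again, that
is, exactly when the partialization can be iterated. -/
theorem hasComplements_iff : HasComplements C ↔ HasMonoPullbacks (Partialization C) := by
  refine ⟨fun _ => inferInstance, fun hP => ⟨fun {i j k} α β _ _ => ?_⟩⟩
  have := HasMonoPullbacks.hasPullback (mk β (𝟙 j)) (incl α)
  obtain ⟨l, p, q, hpq⟩ : ∃ (l : C) (p : of C l ⟶ of C k) (q : of C l ⟶ of C i),
      IsPullback p q (mk β (𝟙 j)) (incl α) :=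
    ⟨_, _, _, IsPullback.of_hasPullback (mk β (𝟙 j)) (incl α)⟩
  have : Mono p := hpq.mono_fst_of_mono
  obtain ⟨δ, _, rfl⟩ := exists_eq_incl_of_mono p
  obtain ⟨d, a, t, _, rfl⟩ := exists_rep q
  -- The pullback of `β` along `ζ` determines the composition of `ζ` with the partial identity.
  have key {m n : C} (ζ : n ⟶ k) (η : m ⟶ n) (ξ : m ⟶ j) (h : IsPullback η ξ ζ β) :
      haveI := h.mono_fst_of_mono
      incl ζ ≫ mk β (𝟙 j) = mk η ξ := by
    have := h.mono_fst_of_mono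
    rw [incl_comp_mk ζ β (𝟙 j) η ξ h, Category.comp_id]
  have hd : IsPullback a (t ≫ α) δ β := by
    have := HasMonoPullbacks.hasPullback δ β
    have h := IsPullback.of_hasPullback δ β
    have e := hpq.w
    rw [key _ _ _ h, mk_comp_incl, mk_eq_iff] at e
    obtain ⟨θ, h₁, h₂⟩ := e
    exact h.of_iso θ (Iso.refl _) (Iso.refl _) (Iso.refl _) (by simp [h₁]) (by simp [h₂])
      (by simp) (by simp)
  have lift {m n : C} (ξ : m ⟶ i) (η : m ⟶ n) (ζ : n ⟶ k) (h : IsPullback η (ξ ≫ α) ζ β) :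
      ∃ φ : n ⟶ l, φ ≫ δ = ζ := by
    have := h.mono_fst_of_mono
    have e : incl ζ ≫ mk β (𝟙 j) = mk η ξ ≫ incl α := by rw [key _ _ _ h, mk_comp_incl]
    obtain ⟨b, c, g, _, hw⟩ := exists_rep (hpq.lift _ _ e)
    have hw' := hpq.lift_fst _ _ e
    rw [hw, mk_comp_incl, incl, mk_eq_iff] at hw'
    obtain ⟨τ, h₁, h₂⟩ := hw'
    exact ⟨τ.inv ≫ g, by rw [Category.assoc, ← h₂, Iso.inv_hom_id_assoc]⟩
  have h₁ : IsPullback (𝟙 i) (𝟙 i ≫ α) (α ≫ β) β := by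
    rw [Category.id_comp]
    refine IsPullback.mk' (by simp) (fun _ _ _ h _ => by simpa using h) (fun z b c e => ?_)
    rw [← Category.assoc, cancel_mono] at e
    exact ⟨b, by simp, e⟩
  obtain ⟨γ, hγ⟩ := lift (𝟙 i) (𝟙 i) (α ≫ β) h₁
  have : Mono (γ ≫ δ) := by rw [hγ]; infer_instance
  have : Mono γ := mono_of_mono γ δ
  refine ⟨l, γ, δ, inferInstance, inferInstance, ?_, fun {m n} ξ η ζ h => ?_⟩
  · refine IsPullback.mk' hγ (fun _ _ _ h _ => (cancel_mono γ).1 h) (fun z b c e => ?_)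
    have hz := hd.lift_fst _ _ e
    have hz' := hd.lift_snd _ _ e
    refine ⟨hd.lift _ _ e ≫ t, ?_, by rw [Category.assoc, hz']⟩
    rw [← cancel_mono δ, Category.assoc, hγ, e, ← Category.assoc, Category.assoc _ t α, hz']
  · obtain ⟨φ, hφ⟩ := lift ξ η ζ h
    refine ⟨φ, hφ, ?_⟩
    rw [← cancel_mono δ, Category.assoc, hφ, h.w, Category.assoc, Category.assoc, hγ]

end Category

end Partialization

/-! ## Iterations -/

/-- A category structure on a fixed type of objects satisfying the two conditions. -/
structure IterableCategory (Ob : Type u) where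
  cat : SmallCategory Ob
  pullbacks : HasMonoPullbacks Ob
  complements : HasComplements Ob

/-- `𝒫` as an operation on such category structures. -/
noncomputable def IterableCategory.partialize {Ob : Type u} (S : IterableCategory Ob) :
    IterableCategory Ob :=
  letI := S.cat
  haveI := S.pullbacks
  haveI := S.complements
  { cat := inferInstanceAs (SmallCategory (Partialization Ob))
    pullbacks := inferInstanceAs (HasMonoPullbacks (Partialization Ob))
    complements := inferInstanceAs (HasComplements (Partialization Ob)) }

/-- The category structure of the `n`-fold iteration `𝒫ⁿ(C) = 𝒫(𝒫(⋯𝒫(C)))`. -/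
noncomputable def iterStructure (C : Type u) [SmallCategory C] [HasMonoPullbacks C]
    [HasComplements C] : ℕ → IterableCategory C
  | 0 => ⟨inferInstance, inferInstance, inferInstance⟩
  | n + 1 => (iterStructure C n).partialize

/-- The iteration `𝒫ⁿ(C)`; its objects are those of `C`. -/
def PIter (C : Type u) (_n : ℕ) : Type u := C

namespace PIter

/-- An object of `C`, seen as an object of `𝒫ⁿ(C)`. -/
def of (C : Type u) (n : ℕ) (i : C) : PIter C n := i

variable {C : Type u} [SmallCategory C] [HasMonoPullbacks C] [HasComplements C]

noncomputable instance (n : ℕ) : SmallCategory (PIter C n) := (iterStructure C n).cat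

instance (n : ℕ) : HasMonoPullbacks (PIter C n) := (iterStructure C n).pullbacks

instance (n : ℕ) : HasComplements (PIter C n) := (iterStructure C n).complements

/-- The canonical inclusion of `C` into `𝒫ⁿ(C)` on morphisms. -/
noncomputable def incl : (n : ℕ) → {i j : C} → (i ⟶ j) → (of C n i ⟶ of C n j)
  | 0, _, _, f => f
  | n + 1, _, _, f => Partialization.incl (C := PIter C n) (incl n f)

theorem incl_id (n : ℕ) (i : C) : incl n (𝟙 i) = 𝟙 (of C n i) := by
  induction n with
  | zero => rfl
  | succ n ih =>
    rw [incl, ih]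
    exact Partialization.incl_id (C := PIter C n) (of C n i)

theorem incl_comp (n : ℕ) {i j k : C} (f : i ⟶ j) (g : j ⟶ k) :
    incl n (f ≫ g) = incl n f ≫ incl n g := by
  induction n with
  | zero => rfl
  | succ n ih =>
    rw [incl, ih]
    exact Partialization.incl_comp (C := PIter C n) (incl n f) (incl n g)

theorem incl_injective (n : ℕ) {i j : C} {f g : i ⟶ j} (h : incl n f = incl n g) : f = g := by
  induction n with
  | zero => exact h
  | succ n ih => exact ih (Partialization.incl_injective (C := PIter C n) h)

instance mono_incl (n : ℕ) {i j : C} (f : i ⟶ j) [Mono f] : Mono (incl n f) := by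
  induction n with
  | zero => assumption
  | succ n ih => exact Partialization.mono_incl (C := PIter C n) (incl n f)

theorem exists_eq_incl_of_mono (n : ℕ) {i j : C} (x : of C n i ⟶ of C n j) (hx : Mono x) :
    ∃ γ : i ⟶ j, Mono γ ∧ x = incl n γ := by
  induction n with
  | zero => exact ⟨x, hx, rfl⟩
  | succ n ih =>
    obtain ⟨y, hy, h⟩ :=
      @Partialization.exists_eq_incl_of_mono (PIter C n) _ _ (of C n i) (of C n j) x hx
    obtain ⟨γ, hγ, rfl⟩ := ih y hy
    exact ⟨γ, hγ, h⟩

/-- The morphism of `𝒫ⁿ⁺¹(C) = 𝒫(𝒫ⁿ(C))` given by the diagram `i ↩ k ⟶ j` in `𝒫ⁿ(C)`, where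
`i ↩ k` is a monomorphism of `C`. -/
noncomputable def mk {n : ℕ} {i j k : C} (α : k ⟶ i) (hα : Mono α) (x : of C n k ⟶ of C n j) :
    of C (n + 1) i ⟶ of C (n + 1) j :=
  Partialization.mk (C := PIter C n) (i := of C n i) (j := of C n j) (incl n α) x

theorem exists_rep {n : ℕ} {i j : C} (x : of C (n + 1) i ⟶ of C (n + 1) j) :
    ∃ (k : C) (α : k ⟶ i) (hα : Mono α) (y : of C n k ⟶ of C n j), x = mk α hα y := by
  obtain ⟨k, a, y, ha, h⟩ :=
    @Partialization.exists_rep (PIter C n) _ _ (of C n i) (of C n j) x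
  obtain ⟨α, hα, rfl⟩ := exists_eq_incl_of_mono (C := C) n (i := k) (j := i) a ha
  exact ⟨k, α, hα, y, h⟩

/-- The isomorphisms of `𝒫ⁿ(C)` are the isomorphisms of `C`. -/
theorem exists_incl_eq_iso (n : ℕ) {i j : C} (θ : of C n i ≅ of C n j) :
    ∃ γ : i ≅ j, incl n γ.hom = θ.hom ∧ incl n γ.inv = θ.inv := by
  obtain ⟨γ, -, h₁⟩ := exists_eq_incl_of_mono n θ.hom inferInstance
  obtain ⟨δ, -, h₂⟩ := exists_eq_incl_of_mono n θ.inv inferInstance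
  exact ⟨⟨γ, δ, incl_injective n (by rw [incl_comp, ← h₁, ← h₂, incl_id, Iso.hom_inv_id]),
    incl_injective n (by rw [incl_comp, ← h₁, ← h₂, incl_id, Iso.inv_hom_id])⟩, h₁.symm, h₂.symm⟩

/-- The image in `𝒫ⁿ(C)` of an isomorphism of `C`. -/
noncomputable def mapIso (n : ℕ) {i j : C} (γ : i ≅ j) : of C n i ≅ of C n j :=
  ⟨incl n γ.hom, incl n γ.inv, by rw [← incl_comp, γ.hom_inv_id, incl_id],
    by rw [← incl_comp, γ.inv_hom_id, incl_id]⟩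

theorem mk_eq_iff {n : ℕ} {i j k k' : C} (α : k ⟶ i) (hα : Mono α) (x : of C n k ⟶ of C n j)
    (α' : k' ⟶ i) (hα' : Mono α') (x' : of C n k' ⟶ of C n j) :
    mk α hα x = mk α' hα' x' ↔ ∃ γ : k ≅ k', γ.hom ≫ α' = α ∧ incl n γ.hom ≫ x' = x := by
  refine (Partialization.mk_eq_iff (C := PIter C n) (i := of C n i) (j := of C n j) (incl n α) x
    (incl n α') x').trans ⟨?_, ?_⟩
  · rintro ⟨θ, h₁, h₂⟩
    obtain ⟨γ, h₃, -⟩ := exists_incl_eq_iso n (i := k) (j := k') θ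
    rw [← h₃] at h₁ h₂
    rw [← incl_comp] at h₁
    exact ⟨γ, incl_injective n h₁, h₂⟩
  · rintro ⟨γ, h₁, h₂⟩
    exact ⟨mapIso n γ, by rw [← h₁, incl_comp]; rfl, h₂⟩

theorem incl_comp_mk {n : ℕ} {i i' j k : C} (γ : i ≅ i') (α : k ⟶ i') (hα : Mono α)
    (x : of C n k ⟶ of C n j) :
    incl (n + 1) γ.hom ≫ mk α hα x = mk (α ≫ γ.inv) (mono_comp α γ.inv) x := by
  have hp : IsPullback (incl n (α ≫ γ.inv)) (𝟙 (of C n k)) (incl n γ.hom) (incl n α) := by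
    have : IsIso (incl n γ.hom) := (mapIso n γ).isIso_hom
    refine IsPullback.of_vert_isIso ⟨?_⟩
    rw [← incl_comp, Category.id_comp, Category.assoc, γ.inv_hom_id, Category.comp_id]
  refine (Partialization.incl_comp_mk (C := PIter C n) (i := of C n i) (j := of C n i')
    (k := of C n j) (incl n γ.hom) (incl n α) x _ _ hp).trans ?_
  rw [Category.id_comp]
  rfl

end PIter

/-! ## Morphisms of the iterations as diagrams in the original category -/

/-- The diagrams `i ↩ kₙ ↩ ⋯ ↩ k₁ ⟶ j` in `C`; the constructor `cons` adds the outermost node. -/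
inductive Diagram {C : Type u} [SmallCategory C] : ℕ → C → C → Type u
  | hom {i j : C} (f : i ⟶ j) : Diagram 0 i j
  | cons {n : ℕ} {i k j : C} (α : k ⟶ i) (hα : Mono α) (D : Diagram n k j) : Diagram (n + 1) i j

namespace Diagram

section Basic

variable {C : Type u} [SmallCategory C]

/-- The diagrams `D` and `D'` are isomorphic through isomorphisms of all nodes which extend
`γ : i ≅ i'` at the outer end and the identity of `j` at the inner end. -/
def IsoOver : {n : ℕ} → {i i' j : C} → (i ≅ i') → Diagram n i j → Diagram n i' j → Prop
  | _, _, _, _, γ, hom f, hom f' => γ.hom ≫ f' = f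
  | _, _, _, _, γ, cons (k := k) α _ D, cons (k := k') α' _ D' =>
      ∃ γ' : k ≅ k', γ'.hom ≫ α' = α ≫ γ.hom ∧ IsoOver γ' D D'

/-- Equivalence of diagrams. -/
def Equiv {n : ℕ} {i j : C} (D D' : Diagram n i j) : Prop := IsoOver (Iso.refl i) D D'

/-- Compose the outermost monomorphism of a diagram with `α`. -/
def postcomp {n : ℕ} {i k j : C} (α : k ⟶ i) (hα : Mono α) :
    Diagram (n + 1) k j → Diagram (n + 1) i j
  | cons β _ D => cons (β ≫ α) (mono_comp β α) D

/-- Double the node `k_s`, for `1 ≤ s ≤ n + 1`, where `k_{n+1}` stands for `i`.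
(For other `s` the node `k₁` is doubled.) -/
def double (s : ℕ) : {n : ℕ} → {i j : C} → Diagram n i j → Diagram (n + 1) i j
  | 0, i, _, hom f => cons (𝟙 i) inferInstance (hom f)
  | n + 1, i, _, cons α hα D =>
      if s = n + 2 then cons (𝟙 i) inferInstance (cons α hα D) else cons α hα (double s D)

/-- Delete the node `k_s` of a diagram with `n + 2` nodes, for `2 ≤ s ≤ n + 2`, composing the two
monomorphisms adjacent to it. (For other `s` the node `k₂` is deleted.) -/
def delete (s : ℕ) : {n : ℕ} → {i j : C} → Diagram (n + 2) i j → Diagram (n + 1) i j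
  | 0, _, _, cons α hα D => postcomp α hα D
  | n + 1, _, _, cons α hα D => if s = n + 3 then postcomp α hα D else cons α hα (delete s D)

/-- Apply a monomorphism-preserving functor to all nodes and arrows of a diagram. -/
def mapFunctor {C' : Type u} [SmallCategory C'] (F : C ⥤ C') [F.PreservesMonomorphisms] :
    {n : ℕ} → {i j : C} → Diagram n i j → Diagram n (F.obj i) (F.obj j)
  | _, _, _, hom f => hom (F.map f)
  | _, _, _, cons α _ D => cons (F.map α) inferInstance (mapFunctor F D)

theorem IsoOver.postcomp {n : ℕ} {i i' k k' j : C} {γ : i ≅ i'} {γ' : k ≅ k'} {α : k ⟶ i}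
    {α' : k' ⟶ i'} (hα : Mono α) (hα' : Mono α') (h : γ'.hom ≫ α' = α ≫ γ.hom)
    {D : Diagram (n + 1) k j} {D' : Diagram (n + 1) k' j} (hD : IsoOver γ' D D') :
    IsoOver γ (D.postcomp α hα) (D'.postcomp α' hα') := by
  cases D with | cons β hβ D
  cases D' with | cons β' hβ' D'
  obtain ⟨δ, h₁, h₂⟩ := hD
  exact ⟨δ, by rw [← Category.assoc, h₁, Category.assoc, h, Category.assoc], h₂⟩

theorem IsoOver.double (s : ℕ) {n : ℕ} {i i' j : C} {γ : i ≅ i'} {D : Diagram n i j}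
    {D' : Diagram n i' j} (h : IsoOver γ D D') : IsoOver γ (D.double s) (D'.double s) := by
  induction D generalizing i' with
  | hom f =>
    cases D' with | hom f'
    exact ⟨γ, by simp, h⟩
  | cons α hα D ih =>
    cases D' with | cons α' hα' D'
    obtain ⟨δ, h₁, h₂⟩ := h
    rw [Diagram.double, Diagram.double]
    split_ifs
    · exact ⟨γ, by simp, δ, h₁, h₂⟩
    · exact ⟨δ, h₁, ih h₂⟩

theorem IsoOver.delete (s : ℕ) {n : ℕ} {i i' j : C} {γ : i ≅ i'} {D : Diagram (n + 2) i j}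
    {D' : Diagram (n + 2) i' j} (h : IsoOver γ D D') : IsoOver γ (D.delete s) (D'.delete s) := by
  induction n generalizing i i' with
  | zero =>
    cases D with | cons α hα D
    cases D' with | cons α' hα' D'
    obtain ⟨δ, h₁, h₂⟩ := h
    exact h₂.postcomp _ _ h₁
  | succ n ih =>
    cases D with | cons α hα D
    cases D' with | cons α' hα' D'
    obtain ⟨δ, h₁, h₂⟩ := h
    rw [Diagram.delete, Diagram.delete]
    split_ifs
    · exact h₂.postcomp _ _ h₁
    · exact ⟨δ, h₁, ih h₂⟩

theorem IsoOver.mapFunctor {C' : Type u} [SmallCategory C'] (F : C ⥤ C')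
    [F.PreservesMonomorphisms] {n : ℕ} {i i' j : C} {γ : i ≅ i'} {D : Diagram n i j}
    {D' : Diagram n i' j} (h : IsoOver γ D D') :
    IsoOver (F.mapIso γ) (D.mapFunctor F) (D'.mapFunctor F) := by
  induction D generalizing i' with
  | hom f =>
    cases D' with | hom f'
    have h : γ.hom ≫ f' = f := h
    exact (F.map_comp _ _).symm.trans (congrArg F.map h)
  | cons α hα D ih =>
    cases D' with | cons α' hα' D'
    obtain ⟨δ, h₁, h₂⟩ := h
    refine ⟨F.mapIso δ, ?_, ih h₂⟩
    simp only [Functor.mapIso_hom, ← F.map_comp, h₁]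

end Basic

section Realization

variable {C : Type u} [SmallCategory C] [HasMonoPullbacks C] [HasComplements C]

/-- The morphism of `𝒫ⁿ(C)` given by a diagram in `C`: the morphism of `𝒫(𝒫ⁿ(C))` given by
`i ↩ kₙ₊₁ ↩ kₙ ↩ ⋯ ↩ k₁ ⟶ j` is the class of `i ↩ kₙ₊₁ ⟶ j`, where the second arrow is the morphism
of `𝒫ⁿ(C)` given by `kₙ₊₁ ↩ kₙ ↩ ⋯ ↩ k₁ ⟶ j`. -/
noncomputable def toHom : {n : ℕ} → {i j : C} → Diagram n i j → (PIter.of C n i ⟶ PIter.of C n j)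
  | 0, _, _, hom f => PIter.incl 0 f
  | _ + 1, _, _, cons α hα D => PIter.mk α hα D.toHom

theorem toHom_cons {n : ℕ} {i j k : C} (α : k ⟶ i) (hα : Mono α) (D : Diagram n k j) :
    (cons α hα D).toHom = PIter.mk α hα D.toHom :=
  rfl

theorem toHom_surjective {n : ℕ} {i j : C} :
    Function.Surjective (toHom : Diagram n i j → (PIter.of C n i ⟶ PIter.of C n j)) := by
  intro x
  induction n generalizing i with
  | zero => exact ⟨hom x, rfl⟩
  | succ n ih =>
    obtain ⟨k, α, hα, y, rfl⟩ := PIter.exists_rep x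
    obtain ⟨D, rfl⟩ := ih y
    exact ⟨cons α hα D, rfl⟩

/-- A diagram representing a given morphism of `𝒫ⁿ(C)`. -/
noncomputable def rep {n : ℕ} {i j : C} (x : PIter.of C n i ⟶ PIter.of C n j) : Diagram n i j :=
  Function.surjInv toHom_surjective x

theorem toHom_rep {n : ℕ} {i j : C} (x : PIter.of C n i ⟶ PIter.of C n j) : (rep x).toHom = x :=
  Function.surjInv_eq toHom_surjective x

theorem isoOver_iff {n : ℕ} {i i' j : C} (γ : i ≅ i') (D : Diagram n i j) (D' : Diagram n i' j) :
    IsoOver γ D D' ↔ PIter.incl n γ.hom ≫ D'.toHom = D.toHom := by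
  induction D generalizing i' with
  | hom f => cases D' with | hom f' => exact Iff.rfl
  | cons α hα D ih =>
    cases D' with | cons α' hα' D'
    rw [toHom_cons, toHom_cons, PIter.incl_comp_mk, eq_comm, PIter.mk_eq_iff]
    refine exists_congr fun δ => and_congr ?_ (ih δ D')
    rw [← Category.assoc, Iso.comp_inv_eq]

/-- The morphisms of `𝒫ⁿ(C)` are the equivalence classes of diagrams. -/
theorem toHom_eq_iff {n : ℕ} {i j : C} (D D' : Diagram n i j) :
    D.toHom = D'.toHom ↔ Equiv D D' := by
  rw [Equiv, isoOver_iff, Iso.refl_hom, PIter.incl_id, Category.id_comp, eq_comm]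

end Realization

end Diagram

/-! ## The transformations -/

section Transformations

/-- The map `𝔣ₙ⁽ˢ⁾ : 𝒫ⁿ(C) → 𝒫ⁿ⁺¹(C)` doubling the node `k_s` of a diagram. -/
noncomputable def doubleNode (C : Type u) [SmallCategory C] [HasMonoPullbacks C]
    [HasComplements C] (n s : ℕ) : PIter C n ⥤q PIter C (n + 1) where
  obj i := PIter.of C (n + 1) i
  map {i j} x := (Diagram.double (C := C) s
    (Diagram.rep (C := C) (n := n) (i := i) (j := j) x)).toHom

/-- The map `𝔱ₙ₊₂⁽ˢ⁾ : 𝒫ⁿ⁺²(C) → 𝒫ⁿ⁺¹(C)` deleting the node `k_s` of a diagram. -/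
noncomputable def deleteNode (C : Type u) [SmallCategory C] [HasMonoPullbacks C]
    [HasComplements C] (n s : ℕ) : PIter C (n + 2) ⥤q PIter C (n + 1) where
  obj i := PIter.of C (n + 1) i
  map {i j} x := (Diagram.delete (C := C) s
    (Diagram.rep (C := C) (n := n + 2) (i := i) (j := j) x)).toHom

/-- The map `𝒫ⁿ(F) : 𝒫ⁿ(C) → 𝒫ⁿ(C')` applying `F` to a diagram. -/
noncomputable def iterMap {C C' : Type u} [SmallCategory C] [HasMonoPullbacks C] [HasComplements C]
    [SmallCategory C'] [HasMonoPullbacks C'] [HasComplements C'] (F : C ⥤ C')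
    [F.PreservesMonomorphisms] (n : ℕ) : PIter C n ⥤q PIter C' n where
  obj i := PIter.of C' n (F.obj i)
  map {i j} x := (Diagram.mapFunctor F
    (Diagram.rep (C := C) (n := n) (i := i) (j := j) x)).toHom

variable {C : Type u} [SmallCategory C] [HasMonoPullbacks C] [HasComplements C]

theorem doubleNode_toHom {n : ℕ} (s : ℕ) {i j : C} (D : Diagram n i j) :
    (doubleNode C n s).map D.toHom = (D.double s).toHom :=
  (Diagram.toHom_eq_iff _ _).2 (((Diagram.toHom_eq_iff _ _).1 (Diagram.toHom_rep D.toHom)).double s)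

theorem deleteNode_toHom {n : ℕ} (s : ℕ) {i j : C} (D : Diagram (n + 2) i j) :
    (deleteNode C n s).map D.toHom = (D.delete s).toHom :=
  (Diagram.toHom_eq_iff _ _).2 (((Diagram.toHom_eq_iff _ _).1 (Diagram.toHom_rep D.toHom)).delete s)

variable {C' : Type u} [SmallCategory C'] [HasMonoPullbacks C'] [HasComplements C'] (F : C ⥤ C')
    [F.PreservesMonomorphisms]

theorem iterMap_toHom {n : ℕ} {i j : C} (D : Diagram n i j) :
    (iterMap F n).map D.toHom = (D.mapFunctor F).toHom := by
  have h := ((Diagram.toHom_eq_iff _ _).1 (Diagram.toHom_rep D.toHom)).mapFunctor F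
  rw [Functor.mapIso_refl] at h
  exact (Diagram.toHom_eq_iff _ _).2 h

/-- `𝒫ⁿ(F)` is the iteration of `i ↩ k ⟶ j ↦ F(i) ↩ F(k) ⟶ F(j)`. -/
theorem iterMap_mk {n : ℕ} {i j k : C} (α : k ⟶ i) (hα : Mono α)
    (x : PIter.of C n k ⟶ PIter.of C n j) :
    (iterMap F (n + 1)).map (PIter.mk α hα x) =
      PIter.mk (j := F.obj j) (F.map α) (F.map_mono α) ((iterMap F n).map x) := by
  obtain ⟨D, rfl⟩ := Diagram.toHom_surjective x
  exact (iterMap_toHom F (Diagram.cons α hα D)).trans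
    (congrArg (PIter.mk (F.map α) (F.map_mono α)) (iterMap_toHom F D).symm)

end Transformations

/-- A family of maps `τ_C : 𝒫ⁿ(C) → 𝒫ᵐ(C)` is a natural transformation from `𝒫ⁿ` to `𝒫ᵐ`: each
`τ_C` is a functor preserving monomorphisms, and `τ_{C'} ∘ 𝒫ⁿ(F) = 𝒫ᵐ(F) ∘ τ_C` for every functor
`F : C ⥤ C'` preserving monomorphisms. -/
structure IsNaturalTransformation {n m : ℕ}
    (τ : ∀ (C : Type u) [SmallCategory C] [HasMonoPullbacks C] [HasComplements C],
      PIter C n ⥤q PIter C m) : Prop where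
  isFunctor : ∀ (C : Type u) [SmallCategory C] [HasMonoPullbacks C] [HasComplements C],
    ∃ Φ : PIter C n ⥤ PIter C m, Φ.toPrefunctor = τ C ∧ Φ.PreservesMonomorphisms
  naturality : ∀ (C C' : Type u) [SmallCategory C] [HasMonoPullbacks C] [HasComplements C]
    [SmallCategory C'] [HasMonoPullbacks C'] [HasComplements C'] (F : C ⥤ C')
    [F.PreservesMonomorphisms], iterMap F n ⋙q τ C' = τ C ⋙q iterMap F m

/-! ## Functors that induce functors of partializations -/

/-! The relations between doubling and deleting, and naturality, are already equalities of diagrams: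
inserting or composing away identities commutes with operations at other nodes and with any functor.
They pass to morphisms because every morphism is the class of a diagram (`Diagram.toHom_surjective`)
and the node maps act on classes (`doubleNode_toHom`, `deleteNode_toHom`). Injectivity and
surjectivity follow from the one-sided inverses.

The real content is that the node maps respect composition. View `𝒫ⁿ⁺¹(C)` as `𝒫(𝒫ⁿ(C))`. Doubling
the outer end is the canonical inclusion of a category into its partialization; deleting the
outermost node is the flattening `𝒫(𝒫(D)) → 𝒫(D)`, which composes two monomorphisms. At any other
node the map is `𝒫` applied to the corresponding map one level down.

For the induction, `𝒫(τ)` must inherit whatever is assumed of `τ`. Composition in `𝒫` uses pullbacks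
of monomorphisms, so `τ` has to preserve these; but pullbacks in `𝒫(C)` are built from pullbacks and
complements in `C` (`isPullback_mk`), so complements have to be preserved too. `IsPartializable`
collects these conditions; one preserved complement per pair suffices, since pullbacks are unique up
to isomorphism. It holds for the inclusion and the flattening and passes from `τ` to `𝒫(τ)`. -/

section Partializable

variable {C D : Type u} [SmallCategory C] [SmallCategory D]

/-- A map of categories is partializable if it is a functor preserving monomorphisms, pullbacks of
monomorphisms, and some complement diagram of any two composable monomorphisms. -/
structure IsPartializable (τ : C ⥤q D) : Prop where
  map_id : ∀ i : C, τ.map (𝟙 i) = 𝟙 (τ.obj i)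
  map_comp : ∀ {i j k : C} (f : i ⟶ j) (g : j ⟶ k), τ.map (f ≫ g) = τ.map f ≫ τ.map g
  map_mono : ∀ {i j : C} (f : i ⟶ j) [Mono f], Mono (τ.map f)
  map_isPullback : ∀ {i j k l : C} {p : l ⟶ i} {q : l ⟶ k} {f : i ⟶ j} {α : k ⟶ j} [Mono α],
    IsPullback p q f α → IsPullback (τ.map p) (τ.map q) (τ.map f) (τ.map α)
  exists_isComplement : ∀ {i j k : C} (α : i ⟶ j) (β : j ⟶ k) [Mono α] [Mono β],
    ∃ (l : C) (γ : i ⟶ l) (δ : l ⟶ k), Mono γ ∧ Mono δ ∧ IsComplement α β γ δ ∧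
      IsComplement (τ.map α) (τ.map β) (τ.map γ) (τ.map δ)

/-- A functor preserving one pullback square over a cospan preserves all of them. -/
theorem CategoryTheory.IsPullback.map_of_map (F : C ⥤ D) {i j k l l' : C} {p : l ⟶ i} {q : l ⟶ k}
    {p' : l' ⟶ i} {q' : l' ⟶ k} {f : i ⟶ j} {g : k ⟶ j} (h : IsPullback p q f g)
    (hF : IsPullback (F.map p) (F.map q) (F.map f) (F.map g)) (h' : IsPullback p' q' f g) :
    IsPullback (F.map p') (F.map q') (F.map f) (F.map g) :=
  hF.of_iso (F.mapIso (h.isoIsPullback _ _ h')) (Iso.refl _) (Iso.refl _) (Iso.refl _)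
    (by simp [← F.map_comp]) (by simp [← F.map_comp]) (by simp) (by simp)

end Partializable

/-- Complement diagrams paste along the second monomorphism. -/
theorem IsComplement.paste {C : Type u} [SmallCategory C] [HasMonoPullbacks C]
    {i j k n l m : C} {β' : i ⟶ j} {ξ : j ⟶ k} {α : k ⟶ n} {α' : i ⟶ l} {β'' : l ⟶ k}
    {γ : l ⟶ m} {δ : m ⟶ n} [Mono α] (h : IsComplement β' ξ α' β'')
    (h' : IsComplement β'' α γ δ) : IsComplement β' (ξ ≫ α) (α' ≫ γ) δ where
  isPullback := h.isPullback.paste_horiz h'.isPullback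
  exists_lift ρ η ζ hp := by
    -- Pull `ζ` back along `ξ ≫ α` in two stages. The first complement makes the projection of the
    -- pullback of `ζ` and `α` to `k` factor through `β''`, which is the hypothesis that the second
    -- complement asks for.
    have := HasMonoPullbacks.hasPullback ζ α
    have hu := IsPullback.of_hasPullback ζ α
    have w : η ≫ ζ = ((ρ ≫ β') ≫ ξ) ≫ α := hp.w.trans (Category.assoc _ _ _).symm
    obtain ⟨φ, h₁, h₂⟩ := h.exists_lift ρ (hu.lift _ _ w) (pullback.snd ζ α)
      (IsPullback.of_right (by rwa [hu.lift_fst]) (hu.lift_snd _ _ w) hu)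
    obtain ⟨ψ, h₃, h₄⟩ := h'.exists_lift φ (pullback.fst ζ α) ζ (by rwa [h₁])
    refine ⟨ψ, h₃, ?_⟩
    rw [← hu.lift_fst _ _ w, Category.assoc, h₄, ← Category.assoc, h₂, Category.assoc]

/-! ### Partializable maps: the inclusion, `𝒫` of a map, and the flattening -/

namespace Partialization

theorem mk_congr {C : Type u} [SmallCategory C] [HasMonoPullbacks C] {i j k : C} {α α' : k ⟶ i} {f f' : k ⟶ j} [Mono α] [Mono α'] (hα : α = α')
    (hf : f = f') : mk α f = mk α' f' := by
  subst hα hf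
  rfl

variable {C : Type u} [SmallCategory C] [HasMonoPullbacks C] [HasComplements C]

/-- The canonical inclusion of a category into its partialization is partializable. -/
theorem isPartializable_incl
    (m : ∀ {i j : C}, (i ⟶ j) → (of C i ⟶ of C j))
    (hm : ∀ {i j : C} (f : i ⟶ j), m f = incl f) :
    IsPartializable (⟨of C, m⟩ : C ⥤q Partialization C) where
  map_id i := (hm _).trans (incl_id i)
  map_comp f g := by simp only [hm, incl_comp]
  map_mono f _ := by
    simp only [hm]
    infer_instance
  map_isPullback {i j k l p q f α} _ h := by
    have := h.mono_fst_of_mono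
    simp only [hm]
    -- The left leg of `incl f` is an identity, so the complement entering the pullback in `𝒫(C)` is
    -- the trivial one and nothing but the square of `C` remains.
    exact isPullback_mk (𝟙 i) f α h (isComplement_id p)
  exists_isComplement α β _ _ := by
    obtain ⟨l, γ, δ, _, _, h⟩ := HasComplements.exists_isComplement α β
    refine ⟨l, γ, δ, inferInstance, inferInstance, h, ?_⟩
    simp only [hm]
    exact isComplement_incl h

/-- Applying a partializable map to both arrows of a diagram is partializable. -/
theorem isPartializable_map {D : Type u} [SmallCategory D] [HasMonoPullbacks D]
    [HasComplements D] {τ : C ⥤q D} (hτ : IsPartializable τ)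
    (m : ∀ {i j : C}, (of C i ⟶ of C j) → (of D (τ.obj i) ⟶ of D (τ.obj j)))
    (hm : ∀ {i j k : C} (α : k ⟶ i) (f : k ⟶ j) [Mono α] [Mono (τ.map α)],
      m (mk α f) = mk (τ.map α) (τ.map f)) :
    IsPartializable (⟨τ.obj, m⟩ : Partialization C ⥤q Partialization D) := by
  have hincl {i j : C} (f : i ⟶ j) : m (incl f) = incl (τ.map f) := by
    have := hτ.map_mono (𝟙 i)
    exact (hm (𝟙 i) f).trans (mk_congr (hτ.map_id i) rfl)
  have hcomp {i j k : C} (x : of C i ⟶ of C j) (y : of C j ⟶ of C k) :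
      m (x ≫ y) = m x ≫ m y := by
    obtain ⟨a, α, f, _, rfl⟩ := exists_rep x
    obtain ⟨b, β, g, _, rfl⟩ := exists_rep y
    have := HasMonoPullbacks.hasPullback f β
    have h := IsPullback.of_hasPullback f β
    have := hτ.map_mono α
    have := hτ.map_mono β
    have := hτ.map_mono (pullback.fst f β)
    have := hτ.map_mono (pullback.fst f β ≫ α)
    -- The pullback computing the composite in `𝒫(C)` is sent by `τ` to one computing the composite
    -- in `𝒫(D)`.
    rw [hm, hm, mk_comp_mk α f β g _ _ h, hm,
      mk_comp_mk (τ.map α) (τ.map f) (τ.map β) (τ.map g) _ _ (hτ.map_isPullback h)]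
    exact mk_congr (hτ.map_comp _ _) (hτ.map_comp _ _)
  have hid (i : C) : m (𝟙 (of C i)) = 𝟙 (of D (τ.obj i)) := by
    rw [← incl_id, hincl, hτ.map_id, incl_id]
  refine ⟨hid, hcomp, ?_, ?_, ?_⟩
  · intro i j x _
    induction i using ind with | _ i
    induction j using ind with | _ j
    obtain ⟨γ, _, rfl⟩ := exists_eq_incl_of_mono (C := C) x
    have := hτ.map_mono γ
    change Mono (m (incl γ))
    rw [hincl]
    infer_instance
  · intro i j k l p q x y _ h
    induction i using ind with | _ i
    induction j using ind with | _ j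
    induction k using ind with | _ k
    obtain ⟨β, _, rfl⟩ := exists_eq_incl_of_mono (C := C) y
    obtain ⟨n, α, f, _, rfl⟩ := exists_rep x
    have := HasMonoPullbacks.hasPullback f β
    have hf := IsPullback.of_hasPullback f β
    -- An arbitrary complement need not be known to survive `τ`; this one does. The pullback built
    -- from it is therefore preserved, and `IsPullback.map_of_map` transfers this to the given
    -- square.
    obtain ⟨n, γ, δ, _, _, hc, hc'⟩ := hτ.exists_isComplement (pullback.fst f β) α
    have := hτ.map_mono α
    have := hτ.map_mono β
    have := hτ.map_mono γ
    have := hτ.map_mono δ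
    refine IsPullback.map_of_map
      (⟨τ.obj, m, hid, hcomp⟩ : Partialization C ⥤ Partialization D)
      (isPullback_mk α f β hf hc) ?_ h
    change IsPullback (m (incl δ)) (m (mk γ _)) (m (mk α f)) (m (incl β))
    rw [hincl, hincl, hm, hm]
    exact isPullback_mk _ _ _ (hτ.map_isPullback hf) hc'
  · intro i j k x y _ _
    induction i using ind with | _ i
    induction j using ind with | _ j
    induction k using ind with | _ k
    obtain ⟨α, _, rfl⟩ := exists_eq_incl_of_mono x
    obtain ⟨β, _, rfl⟩ := exists_eq_incl_of_mono y
    obtain ⟨l, γ, δ, _, _, hc, hc'⟩ := hτ.exists_isComplement α β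
    have := hτ.map_mono α
    have := hτ.map_mono β
    have := hτ.map_mono γ
    have := hτ.map_mono δ
    refine ⟨of C l, incl γ, incl δ, inferInstance, inferInstance, isComplement_incl hc, ?_⟩
    change IsComplement (m (incl α)) (m (incl β)) (m (incl γ)) (m (incl δ))
    simp only [hincl]
    exact isComplement_incl hc'

/-- Composing the two monomorphisms of a diagram `i ↩ k ↩ l ⟶ j` is partializable. -/
theorem isPartializable_flatten
    (m : ∀ {i j : C}, (of (Partialization C) (of C i) ⟶ of (Partialization C) (of C j)) →
      (of C i ⟶ of C j))
    (hm : ∀ {i j k l : C} (α : k ⟶ i) (β : l ⟶ k) (f : l ⟶ j) [Mono α] [Mono β]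
      [Mono (β ≫ α)],
      m (mk (C := Partialization C) (incl α) (mk β f)) = mk (β ≫ α) f) :
    IsPartializable (⟨fun i => i, m⟩ : Partialization (Partialization C) ⥤q Partialization C) := by
  -- Monomorphisms of `𝒫(C)` come from `C`, so every morphism of `𝒫(𝒫(C))` has the shape on which
  -- `hm` prescribes `m`.
  have hrep {i j : C} (x : of (Partialization C) (of C i) ⟶ of (Partialization C) (of C j)) :
      ∃ (k l : C) (α : k ⟶ i) (β : l ⟶ k) (f : l ⟶ j) (_ : Mono α) (_ : Mono β),
        x = mk (C := Partialization C) (incl α) (mk β f) := by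
    obtain ⟨k, a, y, _, rfl⟩ := exists_rep (C := Partialization C) x
    induction k using ind with | _ k
    obtain ⟨α, _, rfl⟩ := exists_eq_incl_of_mono a
    obtain ⟨l, β, f, _, rfl⟩ := exists_rep y
    exact ⟨k, l, α, β, f, inferInstance, inferInstance, rfl⟩
  have hincl {i j : C} (f : i ⟶ j) : m (incl (C := Partialization C) (incl f)) = incl f := by
    have := mono_comp (𝟙 i) (𝟙 i)
    exact (hm (𝟙 i) (𝟙 i) f).trans (mk_congr (Category.id_comp _) rfl)
  -- Pulling back in `𝒫(𝒫(C))` takes two successive complements, past `β` and then past `α`; in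
  -- `𝒫(C)` it takes one, past `β ≫ α`. By `IsComplement.paste` the two agree, so the second square
  -- is the flattening of the first.
  have hpb {i j k l n : C} (α : k ⟶ i) (β : l ⟶ k) (f : l ⟶ j) (γ : n ⟶ j) [Mono α] [Mono β]
      [Mono γ] [Mono (β ≫ α)] : ∃ (q p r : C) (δ : q ⟶ i) (ε : p ⟶ q) (α' : r ⟶ p) (f' : r ⟶ n)
        (_ : Mono ε) (_ : Mono α') (_ : Mono (α' ≫ ε)),
        IsPullback (incl (C := Partialization C) (incl δ))
          (mk (C := Partialization C) (incl ε) (mk α' f'))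
          (mk (C := Partialization C) (incl α) (mk β f))
          (incl (C := Partialization C) (incl γ)) ∧
        IsPullback (incl δ) (mk (α' ≫ ε) f') (mk (β ≫ α) f) (incl γ) := by
    have := HasMonoPullbacks.hasPullback f γ
    have hf := IsPullback.of_hasPullback f γ
    obtain ⟨p, α', β'', _, _, hc⟩ := HasComplements.exists_isComplement (pullback.fst f γ) β
    obtain ⟨q, ε, δ, _, _, hc'⟩ := HasComplements.exists_isComplement β'' α
    exact ⟨q, p, _, δ, ε, α', _, inferInstance, inferInstance, inferInstance,
      isPullback_mk (C := Partialization C) (incl α) (mk β f) (incl γ) (isPullback_mk β f γ hf hc)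
        (isComplement_incl hc'),
      isPullback_mk _ f γ hf (hc.paste hc')⟩
  have hid (i : C) : m (𝟙 (of (Partialization C) (of C i))) = 𝟙 (of C i) := by
    rw [← incl_id, ← incl_id, hincl]
  have hcomp {i j k : C} (x : of (Partialization C) (of C i) ⟶ of (Partialization C) (of C j))
      (y : of (Partialization C) (of C j) ⟶ of (Partialization C) (of C k)) :
      m (x ≫ y) = m x ≫ m y := by
    obtain ⟨a, b, α, β, f, _, _, rfl⟩ := hrep x
    obtain ⟨c, d, γ, ε, g, _, _, rfl⟩ := hrep y
    have := HasMonoPullbacks.hasPullback f γ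
    have hf := IsPullback.of_hasPullback f γ
    obtain ⟨p, α', β', _, _, hc⟩ := HasComplements.exists_isComplement (pullback.fst f γ) β
    have := HasMonoPullbacks.hasPullback (pullback.snd f γ) ε
    have hs := IsPullback.of_hasPullback (pullback.snd f γ) ε
    have := mono_comp β α
    have := mono_comp ε γ
    have := mono_comp (pullback.fst (pullback.snd f γ) ε) α'
    have := mono_comp β' α
    have := mono_comp (pullback.fst (pullback.snd f γ) ε ≫ α') (β' ≫ α)
    have := mono_comp (pullback.fst (pullback.snd f γ) ε ≫ pullback.fst f γ) (β ≫ α)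
    have := mono_comp (incl β') (incl α)
    rw [mk_comp_mk (C := Partialization C) _ _ _ _ _ _ (isPullback_mk β f γ hf hc),
      mk_comp_mk _ _ _ _ _ _ hs, hm, hm,
      mk_comp_mk _ _ _ _ _ _ (hs.paste_horiz hf),
      mk_congr (C := Partialization C) (incl_comp β' α).symm rfl, hm]
    -- The two left legs differ only in following `α' ≫ β'` or `pullback.fst f γ ≫ β`, the two ways
    -- around the complement square.
    refine mk_congr ?_ rfl
    rw [Category.assoc, Category.assoc, ← Category.assoc α', hc.isPullback.w, Category.assoc]
  refine ⟨hid, hcomp, ?_, ?_, ?_⟩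
  · intro i j x _
    induction i using ind with | _ i
    induction i using ind with | _ i
    induction j using ind with | _ j
    induction j using ind with | _ j
    obtain ⟨y, _, rfl⟩ := exists_eq_incl_of_mono (C := Partialization C) x
    obtain ⟨γ, _, rfl⟩ := exists_eq_incl_of_mono (C := C) y
    change Mono (m (incl (C := Partialization C) (incl γ)))
    rw [hincl]
    infer_instance
  · intro i j k l p q x y _ h
    induction i using ind with | _ i
    induction i using ind with | _ i
    induction j using ind with | _ j
    induction j using ind with | _ j
    induction k using ind with | _ k
    induction k using ind with | _ k
    obtain ⟨y, _, rfl⟩ := exists_eq_incl_of_mono (C := Partialization C) y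
    obtain ⟨γ, _, rfl⟩ := exists_eq_incl_of_mono (C := C) y
    obtain ⟨a, b, α, β, f, _, _, rfl⟩ := hrep x
    have := mono_comp β α
    obtain ⟨_, _, _, δ, ε, α', f', _, _, _, h₂, h₃⟩ := hpb α β f γ
    refine IsPullback.map_of_map
      (⟨fun i => i, m, hid, hcomp⟩ : Partialization (Partialization C) ⥤ Partialization C)
      h₂ ?_ h
    rw [← hincl δ, ← hm ε α' f', ← hm α β f, ← hincl γ] at h₃
    exact h₃
  · intro i j k x y _ _
    induction i using ind with | _ i
    induction i using ind with | _ i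
    induction j using ind with | _ j
    induction j using ind with | _ j
    induction k using ind with | _ k
    induction k using ind with | _ k
    obtain ⟨x, _, rfl⟩ := exists_eq_incl_of_mono (C := Partialization C) x
    obtain ⟨α, _, rfl⟩ := exists_eq_incl_of_mono (C := C) x
    obtain ⟨y, _, rfl⟩ := exists_eq_incl_of_mono (C := Partialization C) y
    obtain ⟨β, _, rfl⟩ := exists_eq_incl_of_mono (C := C) y
    obtain ⟨l, γ, δ, _, _, hc⟩ := HasComplements.exists_isComplement α β
    have h := isComplement_incl hc
    have h' := isComplement_incl h
    have hγ := mono_incl γ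
    have hδ := mono_incl δ
    rw [← hincl α, ← hincl β, ← hincl γ, ← hincl δ] at h
    exact ⟨l, incl (C := Partialization C) (incl γ), incl (C := Partialization C) (incl δ),
      @mono_incl (Partialization C) _ _ _ _ _ hγ, @mono_incl (Partialization C) _ _ _ _ _ hδ,
      h', h⟩

end Partialization

/-- Bridge between diagrams, whose monomorphisms lie in `C`, and one-step partialization, whose
monomorphisms lie in `𝒫ⁿ(C)`. -/
theorem PIter.mk_eq_mk {C : Type u} [SmallCategory C] [HasMonoPullbacks C] [HasComplements C]
    {n : ℕ} {i j k : C} (α : k ⟶ i) (hα : Mono α) {a : PIter.of C n k ⟶ PIter.of C n i} (ha : Mono a)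
    (h : PIter.incl n α = a) (x : PIter.of C n k ⟶ PIter.of C n j) :
    PIter.mk α hα x =
      Partialization.mk (C := PIter C n) (i := PIter.of C n i) (j := PIter.of C n j) a x :=
  Partialization.mk_congr (C := PIter C n) h rfl

/-! ### Doubling and deleting nodes as operations on diagrams -/

namespace Diagram

variable {C : Type u} [SmallCategory C]

theorem cons_congr {n : ℕ} {i k j : C} {α α' : k ⟶ i} {hα : Mono α} {hα' : Mono α'}
    (h : α = α') (D : Diagram n k j) : cons α hα D = cons α' hα' D := by
  subst h
  rfl

theorem double_cons_of_eq {n s : ℕ} (hs : s = n + 2) {i k j : C} (α : k ⟶ i) (hα : Mono α)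
    (D : Diagram n k j) :
    (cons α hα D).double s = cons (𝟙 i) inferInstance (cons α hα D) :=
  if_pos hs

theorem double_cons_of_ne {n s : ℕ} (hs : s ≠ n + 2) {i k j : C} (α : k ⟶ i) (hα : Mono α)
    (D : Diagram n k j) : (cons α hα D).double s = cons α hα (D.double s) :=
  if_neg hs

theorem delete_cons_of_eq {n s : ℕ} (hs : s = n + 2) {i k j : C} (α : k ⟶ i) (hα : Mono α)
    (D : Diagram (n + 1) k j) : (cons α hα D).delete s = D.postcomp α hα := by
  cases n with
  | zero => rfl
  | succ n => exact if_pos hs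

theorem delete_cons_of_ne {n s : ℕ} (hs : s ≠ n + 3) {i k j : C} (α : k ⟶ i) (hα : Mono α)
    (D : Diagram (n + 2) k j) : (cons α hα D).delete s = cons α hα (D.delete s) :=
  if_neg hs

theorem postcomp_id {n : ℕ} {i j : C} (h : Mono (𝟙 i)) (D : Diagram (n + 1) i j) :
    D.postcomp (𝟙 i) h = D := by
  cases D with | cons β hβ D
  exact cons_congr (Category.comp_id β) D

/-- The doubled node lies inside the arrow being extended. At `s = n + 2` the two sides would double
different objects, `i` and `k`. -/
theorem double_postcomp_of_le {n s : ℕ} (hs : s ≤ n + 1) {i k j : C} (α : k ⟶ i) (hα : Mono α)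
    (D : Diagram (n + 1) k j) : (D.postcomp α hα).double s = (D.double s).postcomp α hα := by
  cases D with | cons β hβ D
  rw [postcomp, double_cons_of_ne (by omega), double_cons_of_ne (by omega)]
  rfl

/-- After doubling, the copies of `k_s` are numbered `s` and `s + 1`. Here the inner one goes,
leaving an arrow `α ≫ 𝟙`; in `delete_succ_double` the outer one goes, leaving `𝟙 ≫ α`. Nodes are
numbered from the inside, so stripping the outermost arrow in the induction does not shift `s`. -/
theorem delete_double {n s : ℕ} (hs : 2 ≤ s) (hs' : s ≤ n + 2) {i j : C}
    (D : Diagram (n + 1) i j) : (D.double s).delete s = D := by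
  induction n generalizing i with
  | zero =>
    cases D with | cons α hα D
    rw [double_cons_of_eq (by omega), delete_cons_of_eq (by omega), postcomp_id]
  | succ n ih =>
    cases D with | cons α hα D
    obtain rfl | h := eq_or_ne s (n + 3)
    · rw [double_cons_of_eq rfl, delete_cons_of_eq rfl, postcomp_id]
    · rw [double_cons_of_ne h, delete_cons_of_ne h, ih (by omega)]

theorem delete_succ_double {n s : ℕ} (hs : 1 ≤ s) (hs' : s ≤ n + 1) {i j : C}
    (D : Diagram (n + 1) i j) : (D.double s).delete (s + 1) = D := by
  induction n generalizing i with
  | zero =>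
    cases D with | cons α hα D
    cases D with | hom f
    rw [double_cons_of_ne (by omega), delete_cons_of_eq (by omega)]
    exact cons_congr (Category.id_comp α) _
  | succ n ih =>
    cases D with | cons α hα D
    rw [double_cons_of_ne (by omega)]
    obtain rfl | h := eq_or_ne s (n + 2)
    · cases D with | cons β hβ D
      rw [delete_cons_of_eq rfl, double_cons_of_eq rfl]
      exact cons_congr (Category.id_comp α) _
    · rw [delete_cons_of_ne (by omega), ih (by omega)]

/-- The deleted node lies outside both copies of `k_s`; before the doubling its number was `r - 1`.
-/
theorem delete_double_of_lt {n r s : ℕ} (hs : 1 ≤ s) (hrs : s + 1 < r) (hr : r ≤ n + 3) {i j : C}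
    (D : Diagram (n + 2) i j) : (D.double s).delete r = (D.delete (r - 1)).double s := by
  induction n generalizing i with
  | zero =>
    cases D with | cons α hα D
    rw [double_cons_of_ne (by omega), delete_cons_of_eq (by omega),
      delete_cons_of_eq (show r - 1 = 2 by omega),
      double_postcomp_of_le (by omega)]
  | succ n ih =>
    cases D with | cons α hα D
    rw [double_cons_of_ne (by omega)]
    obtain rfl | h := eq_or_ne r (n + 4)
    · rw [delete_cons_of_eq rfl, delete_cons_of_eq (by omega), double_postcomp_of_le (by omega)]
    · rw [delete_cons_of_ne h, delete_cons_of_ne (by omega), double_cons_of_ne (by omega),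
        ih (by omega)]

/-- The deleted node lies inside the doubled one, whose number drops to `s - 1` if the deletion is
done beforehand. -/
theorem delete_double_of_gt {n r s : ℕ} (hr : 2 ≤ r) (hrs : r < s) (hs : s ≤ n + 3) {i j : C}
    (D : Diagram (n + 2) i j) : (D.double s).delete r = (D.delete r).double (s - 1) := by
  induction n generalizing i with
  | zero =>
    cases D with | cons α hα D
    cases D with | cons β hβ D
    rw [double_cons_of_eq (by omega), delete_cons_of_ne (by omega), delete_cons_of_eq (by omega),
      postcomp, double_cons_of_eq (by omega)]
  | succ n ih =>
    cases D with | cons α hα D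
    obtain rfl | h := eq_or_ne s (n + 4)
    · rw [double_cons_of_eq rfl, delete_cons_of_ne (by omega)]
      obtain rfl | h := eq_or_ne r (n + 3)
      · rw [delete_cons_of_eq rfl]
        cases D with | cons β hβ D
        exact (double_cons_of_eq rfl _ _ _).symm
      · rw [delete_cons_of_ne h]
        exact (double_cons_of_eq rfl _ _ _).symm
    · rw [double_cons_of_ne h, delete_cons_of_ne (by omega)]
      obtain rfl | h' := eq_or_ne r (n + 3)
      · omega
      · rw [delete_cons_of_ne h', double_cons_of_ne (by omega), ih (by omega)]

/-- The diagram `i = i = ⋯ = i ⟶ j`. -/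
def ofHom : (n : ℕ) → {i j : C} → (i ⟶ j) → Diagram n i j
  | 0, _, _, f => hom f
  | n + 1, i, _, f => cons (𝟙 i) inferInstance (ofHom n f)

/-- With `delete_ofHom`, this shows that the node maps fix the morphisms coming from `C`, in
particular all monomorphisms. -/
theorem double_ofHom (n s : ℕ) {i j : C} (f : i ⟶ j) : (ofHom n f).double s = ofHom (n + 1) f := by
  induction n with
  | zero => rfl
  | succ n ih =>
    obtain h | h := eq_or_ne s (n + 2)
    · exact double_cons_of_eq h _ _ _
    · rw [ofHom, double_cons_of_ne h, ih]
      rfl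

theorem delete_ofHom (n s : ℕ) {i j : C} (f : i ⟶ j) :
    (ofHom (n + 2) f).delete s = ofHom (n + 1) f := by
  induction n with
  | zero => exact cons_congr (Category.comp_id _) _
  | succ n ih =>
    obtain h | h := eq_or_ne s (n + 3)
    · rw [ofHom, delete_cons_of_eq h, postcomp_id]
    · rw [ofHom, delete_cons_of_ne h, ih]
      rfl

theorem toHom_ofHom [HasMonoPullbacks C] [HasComplements C] (n : ℕ) {i j : C} (f : i ⟶ j) :
    (ofHom n f).toHom = PIter.incl n f := by
  induction n with
  | zero => rfl
  | succ n ih =>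
    rw [ofHom, toHom_cons, ih]
    exact PIter.mk_eq_mk (𝟙 i) inferInstance inferInstance (PIter.incl_id n i) _

variable {C' : Type u} [SmallCategory C'] (F : C ⥤ C') [F.PreservesMonomorphisms]

theorem mapFunctor_postcomp {n : ℕ} {i k j : C} (α : k ⟶ i) (hα : Mono α)
    (D : Diagram (n + 1) k j) :
    (D.postcomp α hα).mapFunctor F = (D.mapFunctor F).postcomp (F.map α) inferInstance := by
  cases D with | cons β hβ D
  exact cons_congr (F.map_comp β α) _

/-- Naturality at the level of diagrams: doubling needs `F.map_id` and deleting needs `F.map_comp`,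
so `F` may fail to preserve pullbacks. -/
theorem mapFunctor_double (s : ℕ) {n : ℕ} {i j : C} (D : Diagram n i j) :
    (D.double s).mapFunctor F = (D.mapFunctor F).double s := by
  induction D with
  | hom f => exact cons_congr (F.map_id _) _
  | @cons n i k j α hα D ih =>
    obtain h | h := eq_or_ne s (n + 2)
    · rw [mapFunctor, double_cons_of_eq h, double_cons_of_eq h]
      exact cons_congr (F.map_id _) _
    · rw [mapFunctor, double_cons_of_ne h, double_cons_of_ne h, ← ih]
      rfl

theorem mapFunctor_delete (s : ℕ) {n : ℕ} {i j : C} (D : Diagram (n + 2) i j) :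
    (D.delete s).mapFunctor F = (D.mapFunctor F).delete s := by
  induction n generalizing i with
  | zero =>
    cases D with | cons α hα D
    exact mapFunctor_postcomp F α hα D
  | succ n ih =>
    cases D with | cons α hα D
    obtain h | h := eq_or_ne s (n + 3)
    · rw [mapFunctor, delete_cons_of_eq h, delete_cons_of_eq h, mapFunctor_postcomp]
    · rw [mapFunctor, delete_cons_of_ne h, delete_cons_of_ne h, ← ih]
      rfl

end Diagram

/-! ### The node maps on morphisms of the iterations -/

section Transformations

variable (C : Type u) [SmallCategory C] [HasMonoPullbacks C] [HasComplements C]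

theorem doubleNode_incl (n s : ℕ) {i j : C} (f : i ⟶ j) :
    (doubleNode C n s).map (PIter.incl n f) = PIter.incl (n + 1) f := by
  rw [← Diagram.toHom_ofHom, doubleNode_toHom, Diagram.double_ofHom, Diagram.toHom_ofHom]

theorem deleteNode_incl (n s : ℕ) {i j : C} (f : i ⟶ j) :
    (deleteNode C n s).map (PIter.incl (n + 2) f) = PIter.incl (n + 1) f := by
  rw [← Diagram.toHom_ofHom, deleteNode_toHom, Diagram.delete_ofHom, Diagram.toHom_ofHom]

variable {C}

/-- Prepending an identity is how `𝒫ⁿ(C)` embeds in `𝒫(𝒫ⁿ(C))`. For `n = 0` the outer end is the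
only node, and it is doubled whatever `s` is. -/
theorem doubleNode_eq_incl {n s : ℕ} (hs : s = n + 1 ∨ n = 0) {i j : C}
    (x : PIter.of C n i ⟶ PIter.of C n j) :
    (doubleNode C n s).map x = Partialization.incl (C := PIter C n) x := by
  obtain ⟨D, rfl⟩ := Diagram.toHom_surjective x
  have hD : D.double s = Diagram.cons (𝟙 i) inferInstance D := by
    cases D with
    | hom f => rfl
    | cons α hα D => exact Diagram.double_cons_of_eq (hs.resolve_right (by simp)) α hα D
  rw [doubleNode_toHom, hD]
  exact PIter.mk_eq_mk (𝟙 i) inferInstance inferInstance (PIter.incl_id n i) _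

/-- The outermost arrow is untouched, so the map is `𝒫` of the doubling one level down. -/
theorem doubleNode_mk {n s : ℕ} (hs : s ≠ n + 2) {i j k : C} (α : k ⟶ i) (hα : Mono α)
    (x : PIter.of C n k ⟶ PIter.of C n j) :
    (doubleNode C (n + 1) s).map (PIter.mk α hα x) =
      PIter.mk α hα ((doubleNode C n s).map x) := by
  obtain ⟨D, rfl⟩ := Diagram.toHom_surjective x
  exact (doubleNode_toHom s (Diagram.cons α hα D)).trans <|
    (congrArg Diagram.toHom (Diagram.double_cons_of_ne hs α hα D)).trans <|
    congrArg (PIter.mk α hα) (doubleNode_toHom s D).symm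

theorem deleteNode_mk_mk {n s : ℕ} (hs : s = n + 2 ∨ n = 0) {i j k l : C} (α : k ⟶ i)
    (hα : Mono α) (β : l ⟶ k) (hβ : Mono β) (x : PIter.of C n l ⟶ PIter.of C n j) :
    (deleteNode C n s).map (PIter.mk α hα (PIter.mk β hβ x)) =
      PIter.mk (β ≫ α) (mono_comp β α) x := by
  obtain ⟨D, rfl⟩ := Diagram.toHom_surjective x
  rw [← Diagram.toHom_cons, ← Diagram.toHom_cons, deleteNode_toHom]
  obtain hs | rfl := hs
  · rw [Diagram.delete_cons_of_eq hs]
    rfl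
  · rfl

theorem deleteNode_mk {n s : ℕ} (hs : s ≠ n + 3) {i j k : C} (α : k ⟶ i) (hα : Mono α)
    (x : PIter.of C (n + 2) k ⟶ PIter.of C (n + 2) j) :
    (deleteNode C (n + 1) s).map (PIter.mk α hα x) =
      PIter.mk α hα ((deleteNode C n s).map x) := by
  obtain ⟨D, rfl⟩ := Diagram.toHom_surjective x
  exact (deleteNode_toHom s (Diagram.cons α hα D)).trans <|
    (congrArg Diagram.toHom (Diagram.delete_cons_of_ne hs α hα D)).trans <|
    congrArg (PIter.mk α hα) (deleteNode_toHom s D).symm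

variable (C)

/-- The induction keeps `s` fixed and so passes through levels where `s` is out of range; there the
default node `k₁` is doubled and the claim still holds. -/
theorem isPartializable_doubleNode (n s : ℕ) : IsPartializable (doubleNode C n s) := by
  have hincl (n : ℕ) (h : s = n + 1 ∨ n = 0) : IsPartializable (doubleNode C n s) :=
    Partialization.isPartializable_incl (C := PIter C n) (doubleNode C n s).map
      fun {i j} x => doubleNode_eq_incl (C := C) (i := i) (j := j) h x
  induction n with
  | zero => exact hincl 0 (Or.inr rfl)
  | succ n ih =>
    obtain h | h := eq_or_ne s (n + 2)
    · exact hincl (n + 1) (Or.inl h)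
    · refine Partialization.isPartializable_map (C := PIter C n) (D := PIter C (n + 1)) ih
        (doubleNode C (n + 1) s).map ?_
      intro i j k α f hα hτα
      obtain ⟨α, hα', rfl⟩ := PIter.exists_eq_incl_of_mono (C := C) n (i := k) (j := i) α hα
      exact (doubleNode_mk (C := C) h α hα' f).trans
        (PIter.mk_eq_mk (C := C) α hα' hτα (doubleNode_incl C n s α).symm _)

theorem isPartializable_deleteNode (n s : ℕ) : IsPartializable (deleteNode C n s) := by
  -- On `𝒫²` the only deletable node is `k₂`, and it is deleted for every `s`; hence the alternative
  -- `n = 0`.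
  have hflat (n : ℕ) (h : s = n + 2 ∨ n = 0) : IsPartializable (deleteNode C n s) := by
    refine Partialization.isPartializable_flatten (C := PIter C n) (deleteNode C n s).map ?_
    intro i j k l α β f hα hβ hβα
    obtain ⟨α, hα', rfl⟩ := PIter.exists_eq_incl_of_mono (C := C) n (i := k) (j := i) α hα
    obtain ⟨β, hβ', rfl⟩ := PIter.exists_eq_incl_of_mono (C := C) n (i := l) (j := k) β hβ
    exact (deleteNode_mk_mk (C := C) h α hα' β hβ' f).trans
      (PIter.mk_eq_mk (C := C) _ _ hβα (PIter.incl_comp (C := C) n β α) f)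
  induction n with
  | zero => exact hflat 0 (Or.inr rfl)
  | succ n ih =>
    obtain h | h := eq_or_ne s (n + 3)
    · exact hflat (n + 1) (Or.inl h)
    · refine Partialization.isPartializable_map (C := PIter C (n + 2)) (D := PIter C (n + 1)) ih
        (deleteNode C (n + 1) s).map ?_
      intro i j k α f hα hτα
      obtain ⟨α, hα', rfl⟩ := PIter.exists_eq_incl_of_mono (C := C) (n + 2) (i := k) (j := i) α hα
      exact (deleteNode_mk (C := C) h α hα' f).trans
        (PIter.mk_eq_mk (C := C) α hα' hτα (deleteNode_incl C n s α).symm _)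

variable {C}

theorem IsPartializable.isFunctor {D E : Type u} [SmallCategory D] [SmallCategory E]
    {τ : D ⥤q E} (h : IsPartializable τ) :
    ∃ Φ : D ⥤ E, Φ.toPrefunctor = τ ∧ Φ.PreservesMonomorphisms :=
  ⟨⟨τ.obj, τ.map, h.map_id, h.map_comp⟩, rfl, ⟨fun f _ => h.map_mono f⟩⟩

/-- Reduces naturality and all relations between node maps to diagrams. Both sides share the object
map `o`, so no transport of morphisms arises. -/
theorem prefunctor_ext_of_toHom {n : ℕ} {D : Type u} [Quiver.{u} D] {o : C → D}
    {m m' : ∀ {i j : C}, (PIter.of C n i ⟶ PIter.of C n j) → (o i ⟶ o j)}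
    (h : ∀ {i j : C} (E : Diagram n i j), m E.toHom = m' E.toHom) :
    (⟨o, m⟩ : PIter C n ⥤q D) = ⟨o, m'⟩ := by
  have : @m = @m' := by
    funext i j x
    obtain ⟨E, rfl⟩ := Diagram.toHom_surjective x
    exact h E
  subst this
  rfl

theorem isNaturalTransformation_doubleNode (n s : ℕ) :
    IsNaturalTransformation.{u} (fun C _ _ _ => doubleNode C n s) where
  isFunctor C _ _ _ := (isPartializable_doubleNode C n s).isFunctor
  naturality C C' _ _ _ _ _ _ F _ := prefunctor_ext_of_toHom (C := C) fun E =>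
    (congrArg (doubleNode C' n s).map (iterMap_toHom F E)).trans <|
      (doubleNode_toHom s _).trans <|
      (congrArg Diagram.toHom (Diagram.mapFunctor_double F s E).symm).trans <|
      (iterMap_toHom F _).symm.trans <|
      congrArg (iterMap F (n + 1)).map (doubleNode_toHom s E).symm

theorem isNaturalTransformation_deleteNode (n s : ℕ) :
    IsNaturalTransformation.{u} (fun C _ _ _ => deleteNode C n s) where
  isFunctor C _ _ _ := (isPartializable_deleteNode C n s).isFunctor
  naturality C C' _ _ _ _ _ _ F _ := prefunctor_ext_of_toHom (C := C) fun E =>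
    (congrArg (deleteNode C' n s).map (iterMap_toHom F E)).trans <|
      (deleteNode_toHom s _).trans <|
      (congrArg Diagram.toHom (Diagram.mapFunctor_delete F s E).symm).trans <|
      (iterMap_toHom F _).symm.trans <|
      congrArg (iterMap F (n + 1)).map (deleteNode_toHom s E).symm

theorem deleteNode_map_doubleNode_map {n s : ℕ} (hs : 2 ≤ s) (hs' : s ≤ n + 2) {i j : C}
    (x : PIter.of C (n + 1) i ⟶ PIter.of C (n + 1) j) :
    (deleteNode C n s).map ((doubleNode C (n + 1) s).map x) = x := by
  obtain ⟨E, rfl⟩ := Diagram.toHom_surjective x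
  rw [doubleNode_toHom]
  refine (deleteNode_toHom s _).trans ?_
  rw [Diagram.delete_double hs hs']

theorem deleteNode_succ_map_doubleNode_map {n s : ℕ} (hs : 1 ≤ s) (hs' : s ≤ n + 1) {i j : C}
    (x : PIter.of C (n + 1) i ⟶ PIter.of C (n + 1) j) :
    (deleteNode C n (s + 1)).map ((doubleNode C (n + 1) s).map x) = x := by
  obtain ⟨E, rfl⟩ := Diagram.toHom_surjective x
  rw [doubleNode_toHom]
  refine (deleteNode_toHom (s + 1) _).trans ?_
  rw [Diagram.delete_succ_double hs hs']

theorem doubleNode_comp_deleteNode {n s : ℕ} (hs : 2 ≤ s) (hs' : s ≤ n + 2) :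
    doubleNode C (n + 1) s ⋙q deleteNode C n s = 𝟭q (PIter C (n + 1)) :=
  prefunctor_ext_of_toHom (C := C) fun E => deleteNode_map_doubleNode_map hs hs' E.toHom

theorem doubleNode_comp_deleteNode_succ {n s : ℕ} (hs : 1 ≤ s) (hs' : s ≤ n + 1) :
    doubleNode C (n + 1) s ⋙q deleteNode C n (s + 1) = 𝟭q (PIter C (n + 1)) :=
  prefunctor_ext_of_toHom (C := C) fun E => deleteNode_succ_map_doubleNode_map hs hs' E.toHom

theorem doubleNode_comp_deleteNode_of_lt {n r s : ℕ} (hs : 1 ≤ s) (hrs : s + 1 < r)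
    (hr : r ≤ n + 3) :
    doubleNode C (n + 2) s ⋙q deleteNode C (n + 1) r =
      deleteNode C n (r - 1) ⋙q doubleNode C (n + 1) s :=
  prefunctor_ext_of_toHom (C := C) fun E =>
    (congrArg (deleteNode C (n + 1) r).map (doubleNode_toHom s E)).trans <|
      (deleteNode_toHom r _).trans <|
      (congrArg Diagram.toHom (Diagram.delete_double_of_lt hs hrs hr E)).trans <|
      (doubleNode_toHom s _).symm.trans <|
      congrArg (doubleNode C (n + 1) s).map (deleteNode_toHom (r - 1) E).symm

theorem doubleNode_comp_deleteNode_of_gt {n r s : ℕ} (hr : 2 ≤ r) (hrs : r < s)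
    (hs : s ≤ n + 3) :
    doubleNode C (n + 2) s ⋙q deleteNode C (n + 1) r =
      deleteNode C n r ⋙q doubleNode C (n + 1) (s - 1) :=
  prefunctor_ext_of_toHom (C := C) fun E =>
    (congrArg (deleteNode C (n + 1) r).map (doubleNode_toHom s E)).trans <|
      (deleteNode_toHom r _).trans <|
      (congrArg Diagram.toHom (Diagram.delete_double_of_gt hr hrs hs E)).trans <|
      (doubleNode_toHom (s - 1) _).symm.trans <|
      congrArg (doubleNode C (n + 1) (s - 1)).map (deleteNode_toHom r E).symm

theorem doubleNode_map_injective {n s : ℕ} (hn : 1 ≤ n) (hs : 1 ≤ s) (hs' : s ≤ n + 1)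
    (i j : C) :
    Function.Injective ((doubleNode C n s).map (X := PIter.of C n i) (Y := PIter.of C n j)) := by
  obtain ⟨n, rfl⟩ := Nat.exists_eq_add_of_le' hn
  -- The outer copy of `k_s` can be deleted unless `k_s` is the outer end; in that case `s = n + 2 ≥
  -- 2` and the inner copy can be.
  obtain h | h := le_or_gt s (n + 1)
  · exact Function.LeftInverse.injective (g := (deleteNode C n (s + 1)).map)
      (deleteNode_succ_map_doubleNode_map (C := C) hs h)
  · exact Function.LeftInverse.injective (g := (deleteNode C n s).map)
      (deleteNode_map_doubleNode_map (C := C) (by omega) hs')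

theorem deleteNode_map_surjective {n s : ℕ} (hs : 2 ≤ s) (hs' : s ≤ n + 2) (i j : C) :
    Function.Surjective
      ((deleteNode C n s).map (X := PIter.of C (n + 2) i) (Y := PIter.of C (n + 2) j)) :=
  Function.RightInverse.surjective
    (g := (doubleNode C (n + 1) s).map (X := PIter.of C (n + 1) i) (Y := PIter.of C (n + 1) j))
    (deleteNode_map_doubleNode_map (C := C) hs hs')

end Transformations

theorem mainTheorem8 :
    -- (i): the map doubling a node, on `𝒫ⁿ` with `n ≥ 1`
    (∀ n s : ℕ, 1 ≤ n → 1 ≤ s → s ≤ n + 1 →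
      IsNaturalTransformation.{u} (fun C _ _ _ => doubleNode C n s) ∧
      ∀ (C : Type u) [SmallCategory C] [HasMonoPullbacks C] [HasComplements C] (i j : PIter C n),
        Function.Injective ((doubleNode C n s).map (X := i) (Y := j))) ∧
    -- (ii): the map `𝔱ₙ₊₂⁽ˢ⁾` deleting a node, from `𝒫ⁿ⁺²` to `𝒫ⁿ⁺¹`
    (∀ n s : ℕ, 2 ≤ s → s ≤ n + 2 →
      IsNaturalTransformation.{u} (fun C _ _ _ => deleteNode C n s) ∧
      ∀ (C : Type u) [SmallCategory C] [HasMonoPullbacks C] [HasComplements C]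
        (i j : PIter C (n + 2)),
        Function.Surjective ((deleteNode C n s).map (X := i) (Y := j))) ∧
    (∀ (C : Type u) [SmallCategory C] [HasMonoPullbacks C] [HasComplements C],
      -- (iii): on `𝒫ⁿ⁺¹`
      (∀ n s : ℕ, 2 ≤ s → s ≤ n + 2 →
        doubleNode C (n + 1) s ⋙q deleteNode C n s = 𝟭q (PIter C (n + 1))) ∧
      (∀ n s : ℕ, 1 ≤ s → s ≤ n + 1 →
        doubleNode C (n + 1) s ⋙q deleteNode C n (s + 1) = 𝟭q (PIter C (n + 1))) ∧
      -- (iv): on `𝒫ⁿ⁺²`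
      (∀ n r s : ℕ, 1 ≤ s → s + 1 < r → r ≤ n + 3 →
        doubleNode C (n + 2) s ⋙q deleteNode C (n + 1) r =
          deleteNode C n (r - 1) ⋙q doubleNode C (n + 1) s) ∧
      -- (v): on `𝒫ⁿ⁺²`
      (∀ n r s : ℕ, 2 ≤ r → r < s → s ≤ n + 3 →
        doubleNode C (n + 2) s ⋙q deleteNode C (n + 1) r =
          deleteNode C n r ⋙q doubleNode C (n + 1) (s - 1))) := by
  exact ⟨fun n s hn hs hs' => ⟨isNaturalTransformation_doubleNode n s,
      fun C _ _ _ i j => doubleNode_map_injective (C := C) hn hs hs' i j⟩,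
    fun n s hs hs' => ⟨isNaturalTransformation_deleteNode n s,
      fun C _ _ _ i j => deleteNode_map_surjective (C := C) hs hs' i j⟩,
    fun C _ _ _ => ⟨fun _ _ => doubleNode_comp_deleteNode,
      fun _ _ => doubleNode_comp_deleteNode_succ, fun _ _ _ => doubleNode_comp_deleteNode_of_lt,
      fun _ _ _ => doubleNode_comp_deleteNode_of_gt⟩⟩
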